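/- Let $d\ge 0$ and $k\ge 1$ be integers and let $\sigma>0$, $\tau>0$, $\varepsilon\ge 0$ be real. A dataset is a finite sequence $X=(X_1,\dots,X_n)$ with $X_i\in\{0,1\}^d$ (with no bound on the number of non-zero entries of $X_i$ or of the histogram); two datasets are neighboring if one is obtained from the other by deleting one data point. A randomized mechanism $M$ is $(\varepsilon,\delta)$-differentially private if $\Pr[M(X)\in Y]\le e^{\varepsilon}\Pr[M(X')\in Y]+\delta$ for all neighboring $X,X'$ and all measurable sets $Y$ of outputs. **Top-$k$ mechanism** with parameters $k,\sigma,\tau$. Given $X$, let $H=\sum_{i=1}^n X_i\in\mathbb N^d$, let $H^{(k+1)}$ be the $(k+1)$-st largest entry of $H$ (counted with multiplicity; $H^{(k+1)}=0$ if $d\le k$), and put $\tilde H_i=\max(0,H_i-H^{(k+1)})$ for $i\in[d]$. Draw independent $Z_{\mathrm{corr}}\sim\mathcal N(0,\sigma^2/\sqrt k)$ and $Z_i\sim\mathcal N(0,\sigma^2)$. Release the vector in $\mathbb R^d$ whose $i$-th entry is $\tilde H_i+Z_i+Z_{\mathrm{corr}}$ if $\tilde H_i\neq 0$ and $\tilde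 H_i+Z_i+Z_{\mathrm{corr}}>1+\tau$, and $0$ otherwise. Let $\Phi$ be the standard normal distribution function, and put $$\delta_{\mathrm{gauss}}=\Phi\Big(\tfrac{\sqrt{k+\sqrt k}}{4\sigma}-\tfrac{2\varepsilon\sigma}{\sqrt{k+\sqrt k}}\Big)-e^{\varepsilon}\,\Phi\Big(-\tfrac{\sqrt{k+\sqrt k}}{4\sigma}-\tfrac{2\varepsilon\sigma}{\sqrt{k+\sqrt k}}\Big),\qquad \delta_{\mathrm{inf}}=1-\Phi\Big(\tfrac{\tau}{\sigma(1+k^{-1/4})}\Big)^{k+1},$$ $$\gamma(j)=\min\Big(\sqrt j,\tfrac12\sqrt{j+\sqrt k}\Big),\qquad \psi(m)=\Phi\Big(\tfrac{\tau}{(1+k^{-1/4})\sigma}\Big)^{m+1},\qquad \hat\varepsilon(j)=\varepsilon+\ln\psi(k-j),$$ $$B(g,e)=\Phi\Big(\tfrac{g}{2\sigma}-\tfrac{e\sigma}{g}\Big)-e^{e}\,\Phi\Big(-\tfrac{g}{2\sigma}-\tfrac{e\sigma}{g}\Big).$$ Then: 1. The top-$k$ mechanism is $(\varepsilon,\delta_{\mathrm{gauss}}+\delta_{\mathrm{inf}})$-differentially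 private. 2. The top-$k$ mechanism is $(\varepsilon,\delta)$-differentially private for every real $\delta$ with $$\max\Big[\,1-\psi(k),\ \ \delta_{\mathrm{gauss}},\ \ \max_{1\le j\le k-1}\big(1-\psi(k-j)+B(\gamma(j),\varepsilon)\big),\ \ \max_{1\le j\le k-1}B\big(\gamma(j),\hat\varepsilon(j)\big)\Big]\le\delta,$$ where the two inner maxima are omitted if $k=1$. -/

import Mathlib

open MeasureTheory ProbabilityTheory

noncomputable section

namespace TopK

/-! ### Datasets, neighbours, differential privacy -/

/-- A dataset over the universe `𝒰` is a finite sequence `(X₁, …, Xₙ)` of data points. -/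
abbrev Dataset (𝒰 : Type*) := List 𝒰

/-- Add-remove neighbours: one of the two datasets is obtained from the other by deleting the
data point at exactly one position. -/
def Neighboring {𝒰 : Type*} (X X' : Dataset 𝒰) : Prop :=
  (∃ i, i < X'.length ∧ X = X'.eraseIdx i) ∨ (∃ i, i < X.length ∧ X' = X.eraseIdx i)

/-- `(ε, δ)`-differential privacy of a randomized mechanism, which is given by the law of its output
on each dataset. -/
def IsDP {𝒰 𝒴 : Type*} [MeasurableSpace 𝒴] (M : Dataset 𝒰 → Measure 𝒴) (ε δ : ℝ) : Prop :=
  ∀ X X' : Dataset 𝒰, Neighboring X X' → ∀ S : Set 𝒴, MeasurableSet S →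
    (M X).real S ≤ Real.exp ε * (M X').real S + δ

/-! ### The correlated stability histogram -/

/-- The joint law of `(Z_corr, (Z_i)_{i ∈ [d]})`: independent, `Z_corr ∼ 𝒩(0, σ² / √k)` and
`Z_i ∼ 𝒩(0, σ²)`. -/
def noise (d k : ℕ) (σ : ℝ) : Measure (ℝ × (Fin d → ℝ)) :=
  (gaussianReal 0 (Real.toNNReal (σ ^ 2 / Real.sqrt k))).prod
    (Measure.pi fun _ : Fin d => gaussianReal 0 (Real.toNNReal (σ ^ 2)))

open Classical in
/-- The histogram released by the correlated stability histogram when the noise is `z`: noise is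
added only to the non-zero counters, and noisy counters that do not exceed `1 + τ` are removed.
(The samples `Z_i` at zero counters are never used.) -/
def cshOutput {d : ℕ} (τ : ℝ) (h : Fin d → ℕ) (z : ℝ × (Fin d → ℝ)) : Fin d → ℝ := fun i =>
  if h i ≠ 0 ∧ 1 + τ < (h i : ℝ) + z.2 i + z.1 then (h i : ℝ) + z.2 i + z.1 else 0

/-- The correlated stability histogram mechanism with parameters `k`, `σ`, `τ` on the histogram `h`
(as the law of its output). -/
def csh {d : ℕ} (k : ℕ) (σ τ : ℝ) (h : Fin d → ℕ) : Measure (Fin d → ℝ) :=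
  (noise d k σ).map (cshOutput τ h)

lemma measurable_cshOutput {d : ℕ} (τ : ℝ) (h : Fin d → ℕ) : Measurable (cshOutput τ h) := by
  refine measurable_pi_lambda _ fun i => ?_
  have hm : Measurable fun z : ℝ × (Fin d → ℝ) => (h i : ℝ) + z.2 i + z.1 := by fun_prop
  refine Measurable.ite ?_ hm measurable_const
  exact (MeasurableSet.const _).inter (measurableSet_lt measurable_const hm)

instance {d : ℕ} (k : ℕ) (σ τ : ℝ) (h : Fin d → ℕ) : IsProbabilityMeasure (csh k σ τ h) := by
  have : IsProbabilityMeasure (noise d k σ) := by unfold noise; infer_instance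
  exact Measure.isProbabilityMeasure_map (measurable_cshOutput τ h).aemeasurable

/-! ### The top-k mechanism -/

/-- The histogram `H(X) = ∑ᵢ Xᵢ` of a dataset of points of `{0,1}^d`. -/
def hist {d : ℕ} (X : Dataset (Fin d → Bool)) : Fin d → ℕ := fun j =>
  (X.map fun x => if x j then 1 else 0).sum

/-- The `(k+1)`-st largest entry `h^{(k+1)}` of `h` (counted with multiplicity), that is, the entry
at position `k + 1` of the list of all entries in descending order; it is `0` if `h` has at
most `k` entries. -/
def succLargest {d : ℕ} (h : Fin d → ℕ) (k : ℕ) : ℕ :=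
  ((Finset.univ.val.map h).sort (· ≥ ·)).getD k 0

/-- The preprocessed histogram `max(0, H(X)_i - H(X)^{(k+1)})` (subtraction in `ℕ` is truncated
at `0`). -/
def topkHist {d : ℕ} (k : ℕ) (X : Dataset (Fin d → Bool)) : Fin d → ℕ := fun i =>
  hist X i - succLargest (hist X) k

/-- The top-k mechanism using correlated Gaussian noise. -/
def topkMechanism (d k : ℕ) (σ τ : ℝ) (X : Dataset (Fin d → Bool)) : Measure (Fin d → ℝ) :=
  csh k σ τ (topkHist k X)

/-! ### The quantities in the privacy guarantees -/

/-- The cumulative distribution function `Φ` of the standard normal distribution. -/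
def Phi (x : ℝ) : ℝ := cdf (gaussianReal 0 1) x

/-- `δ_gauss` of the correlated noise for `k` counters. -/
def deltaGauss (k : ℕ) (σ ε : ℝ) : ℝ :=
  Phi (Real.sqrt (k + Real.sqrt k) / (4 * σ) - 2 * ε * σ / Real.sqrt (k + Real.sqrt k)) -
    Real.exp ε *
      Phi (-(Real.sqrt (k + Real.sqrt k) / (4 * σ)) - 2 * ε * σ / Real.sqrt (k + Real.sqrt k))

/-- `ψ(m) = Φ(τ / ((1 + k^{-1/4}) σ))^{m+1}`. -/
def psi (k : ℕ) (σ τ : ℝ) (m : ℕ) : ℝ :=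
  Phi (τ / ((1 + (k : ℝ) ^ (-(1 / 4) : ℝ)) * σ)) ^ (m + 1)

/-- `δ_inf = 1 - Φ(τ / (σ (1 + k^{-1/4})))^{k+1}`. -/
def deltaInf (k : ℕ) (σ τ : ℝ) : ℝ :=
  1 - Phi (τ / (σ * (1 + (k : ℝ) ^ (-(1 / 4) : ℝ)))) ^ (k + 1)

/-- `γ(j) = min(√j, √(j + √k) / 2)`. -/
def gam (k j : ℕ) : ℝ :=
  min (Real.sqrt j) (1 / 2 * Real.sqrt (j + Real.sqrt k))

/-- `Φ(g / (2σ) - e σ / g) - exp(e) Φ(-g / (2σ) - e σ / g)`. -/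
def gaussProfile (σ g e : ℝ) : ℝ :=
  Phi (g / (2 * σ) - e * σ / g) - Real.exp e * Phi (-(g / (2 * σ)) - e * σ / g)

/-- `ε̂(j) = ε + ln ψ(k - j)`. -/
def epsHat (k : ℕ) (σ τ ε : ℝ) (j : ℕ) : ℝ := ε + Real.log (psi k σ τ (k - j))

/-- The maximum in the tighter analysis is at most `δ`; the inner maxima over
`j ∈ {1, …, k - 1}` are void for `k = 1`. -/
def TighterBound (k : ℕ) (σ τ ε δ : ℝ) : Prop :=
  1 - psi k σ τ k ≤ δ ∧
  deltaGauss k σ ε ≤ δ ∧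
  (∀ j ∈ Finset.Icc 1 (k - 1),
    1 - psi k σ τ (k - j) + gaussProfile σ (gam k j) ε ≤ δ) ∧
  (∀ j ∈ Finset.Icc 1 (k - 1),
    gaussProfile σ (gam k j) (epsHat k σ τ ε j) ≤ δ)

end TopK

end

/-!
# Differential privacy of the top-`k` mechanism with correlated Gaussian noise

Deleting a data point changes `H` by at most one per entry, hence also the threshold `H^{(k+1)}`,
and it moves all preprocessed counters in the same direction (`Neighboring.topkHist`). So it
suffices to compare two histograms `h ≤ h' ≤ h + 1` of which `h'` has at most `k` non-zero counters.
Let `s` be the number of non-zero counters of `h`; then at most `k - s` counters are new in `h'`,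
and each of those is equal to one.

As long as no new counter receives noise above `τ`, the output on `h'` is the output on `h` with
shifted noise (`cshOutput_eq_cshOutput_add`). If `j` of the `s` common counters differ, a part `b` of
the shift is put on `Z_corr`, and the `Z_i` of the common counters absorb the rest. For
`b = j / (√k + s)` the squared length of the shift, measured in units of `σ`, is
`j - j² / (√k + s) ≤ min (s, (s + √k) / 4)` (`shift_cost_le`), so that the length is at most `γ(s)`,
and at most `√(k + √k) / 2` when `s = k`. A shift of Gaussian noise of length at most `g` costs the
Gaussian profile of `g` (`noise_real_add_le`). This is the Neyman-Pearson lemma, since the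
log-likelihood ratio of two translates of a Gaussian measure is Gaussian
(`IsGaussianShift.real_le`).

The failure event has probability at most `1 - ψ(k - s)` (`psi_le_noise_real`). It is correlated
with the output through `Z_corr`, but both directions of the comparison have the additive error
`1 - ψ(k - s)` plus the profile (`csh_real_le_of_shift`): from `h'` to `h` the failure event is
discarded before shifting, and from `h` to `h'` the constraint on the new counters is carried along
by the shift; since `Z_corr` moves up by `b ≥ 0`, the constraint on the shifted noise implies the one
on the original noise. For `s = 0` no shift is needed, and for `s = k` there are no new counters.
-/

open MeasureTheory ProbabilityTheory
open scoped ENNReal NNReal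

namespace TopK

/-! ### Pairs of measures whose log-likelihood ratio is Gaussian -/

/-- `Q` has a density with respect to `P` whose logarithm is `ℓ - w / 2`, where `ℓ` has the law
`𝒩(0, w)` under `P`. This is the relation between a Gaussian measure and its translate by a vector
of squared Mahalanobis norm `w`; it determines how well the two measures can be told apart. -/
def IsGaussianShift {Ω : Type*} [MeasurableSpace Ω] (P Q : Measure Ω) (w : ℝ≥0) : Prop :=
  ∃ ℓ : Ω → ℝ, Measurable ℓ ∧
    Q = P.withDensity (fun x => ENNReal.ofReal (Real.exp (ℓ x - w / 2))) ∧
    P.map ℓ = gaussianReal 0 w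

lemma gaussianReal_eq_withDensity (a : ℝ) {u w : ℝ≥0} (hu : u ≠ 0) (hw : (w : ℝ) = a ^ 2 / u) :
    gaussianReal a u = (gaussianReal 0 u).withDensity
      (fun x => ENNReal.ofReal (Real.exp (a * x / u - w / 2))) := by
  rw [gaussianReal_of_var_ne_zero _ hu, gaussianReal_of_var_ne_zero _ hu,
    ← withDensity_mul _ (measurable_gaussianPDF _ _) (by fun_prop)]
  congr 1
  ext x
  simp only [Pi.mul_apply, gaussianPDF]
  rw [← ENNReal.ofReal_mul (gaussianPDFReal_nonneg _ _ _)]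
  congr 1
  simp only [gaussianPDFReal, mul_assoc, ← Real.exp_add, hw]
  have : (u : ℝ) ≠ 0 := by exact_mod_cast hu
  congr 3
  field_simp
  ring

lemma isGaussianShift_gaussianReal (a : ℝ) {u w : ℝ≥0} (hu : u ≠ 0) (hw : (w : ℝ) = a ^ 2 / u) :
    IsGaussianShift (gaussianReal 0 u) (gaussianReal a u) w := by
  refine ⟨fun x => a * x / u, by fun_prop, gaussianReal_eq_withDensity a hu hw, ?_⟩
  have : (fun x : ℝ => a * x / u) = fun x => a / u * x := by ext x; ring
  have hu' : (u : ℝ) ≠ 0 := by exact_mod_cast hu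
  rw [this, gaussianReal_map_const_mul]
  congr 1
  · simp
  · ext
    simp only [NNReal.coe_mul, NNReal.coe_mk, hw]
    field_simp

lemma IsGaussianShift.prod {Ω Ω' : Type*} [MeasurableSpace Ω] [MeasurableSpace Ω']
    {P Q : Measure Ω} {P' Q' : Measure Ω'} [IsProbabilityMeasure P] [IsProbabilityMeasure P']
    {w w' : ℝ≥0} (h : IsGaussianShift P Q w) (h' : IsGaussianShift P' Q' w') :
    IsGaussianShift (P.prod P') (Q.prod Q') (w + w') := by
  obtain ⟨ℓ, hm, hQ, hl⟩ := h
  obtain ⟨ℓ', hm', hQ', hl'⟩ := h'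
  refine ⟨fun z => ℓ z.1 + ℓ' z.2, by fun_prop, ?_, ?_⟩
  · rw [hQ, hQ', prod_withDensity (by fun_prop) (by fun_prop)]
    congr 1
    ext z
    rw [← ENNReal.ofReal_mul (Real.exp_nonneg _), ← Real.exp_add]
    congr 2
    push_cast
    ring
  · have h1 : (P.prod P').map (fun z => ℓ z.1) = gaussianReal 0 w := by
      rw [← hl, show (fun z : Ω × Ω' => ℓ z.1) = ℓ ∘ Prod.fst from rfl,
        ← Measure.map_map hm measurable_fst]
      simp
    have h2 : (P.prod P').map (fun z => ℓ' z.2) = gaussianReal 0 w' := by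
      rw [← hl', show (fun z : Ω × Ω' => ℓ' z.2) = ℓ' ∘ Prod.snd from rfl,
        ← Measure.map_map hm' measurable_snd]
      simp
    have := gaussianReal_add_gaussianReal_of_indepFun (indepFun_prod hm hm') h1 h2
    rw [add_zero] at this
    exact this

lemma IsGaussianShift.map_equiv {Ω Ω' : Type*} [MeasurableSpace Ω] [MeasurableSpace Ω']
    {P Q : Measure Ω} {w : ℝ≥0} (h : IsGaussianShift P Q w) (e : Ω ≃ᵐ Ω') :
    IsGaussianShift (P.map e) (Q.map e) w := by
  obtain ⟨ℓ, hm, hQ, hl⟩ := h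
  refine ⟨ℓ ∘ e.symm, hm.comp e.symm.measurable, ?_, ?_⟩
  · ext s hs
    rw [e.map_apply, hQ, withDensity_apply _ (e.measurable hs), withDensity_apply _ hs,
      setLIntegral_map hs (by fun_prop) e.measurable]
    simp
  · rw [Measure.map_map (hm.comp e.symm.measurable) e.measurable]
    simpa [Function.comp_assoc] using hl

lemma IsGaussianShift.pi {n : ℕ} {P Q : Fin n → Measure ℝ} [∀ i, IsProbabilityMeasure (P i)]
    [∀ i, IsProbabilityMeasure (Q i)] {w : Fin n → ℝ≥0}
    (h : ∀ i, IsGaussianShift (P i) (Q i) (w i)) :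
    IsGaussianShift (Measure.pi P) (Measure.pi Q) (∑ i, w i) := by
  induction n with
  | zero =>
    refine ⟨fun _ => 0, measurable_const, ?_, ?_⟩
    · rw [Subsingleton.elim Q P]
      simp
    · simp [gaussianReal_zero_var]
  | succ n ih =>
    have hP := (measurePreserving_piFinSuccAbove P 0).symm.map_eq
    have hQ := (measurePreserving_piFinSuccAbove Q 0).symm.map_eq
    rw [← hP, ← hQ, Fin.sum_univ_succ]
    exact ((h 0).prod (ih fun i => h i.succ)).map_equiv _

/-- The Neyman-Pearson bound: among all events the excess `Q E - e^ε P E` is largest for the event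
that the likelihood ratio exceeds `e^ε`, whose probabilities are Gaussian tails. -/
lemma IsGaussianShift.real_le {Ω : Type*} [MeasurableSpace Ω] {P Q : Measure Ω}
    [IsProbabilityMeasure P] [IsProbabilityMeasure Q] {w : ℝ≥0} (h : IsGaussianShift P Q w)
    (hw : w ≠ 0) (ε : ℝ) {E : Set Ω} (hE : MeasurableSet E) :
    Q.real E ≤ Real.exp ε * P.real E + ((gaussianReal w w).real (Set.Ioi (ε + w / 2)) -
      Real.exp ε * (gaussianReal 0 w).real (Set.Ioi (ε + w / 2))) := by
  obtain ⟨ℓ, hm, hQ, hl⟩ := h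
  set f : Ω → ℝ := fun x => Real.exp (ℓ x - w / 2) with hf
  have hfm : Measurable f := by fun_prop
  have hint : Integrable f P := by
    refine ⟨hfm.aestronglyMeasurable, ?_⟩
    rw [hasFiniteIntegral_iff_ofReal (ae_of_all _ fun x => (Real.exp_pos _).le)]
    have : ∫⁻ x, ENNReal.ofReal (f x) ∂P = Q Set.univ := by
      rw [hQ, withDensity_apply _ MeasurableSet.univ, Measure.restrict_univ]
    rw [this]
    exact measure_lt_top _ _
  have hQE : ∀ {A : Set Ω}, MeasurableSet A → Q.real A = ∫ x in A, f x ∂P := by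
    intro A hA
    rw [integral_eq_lintegral_of_nonneg_ae (ae_of_all _ fun x => (Real.exp_pos _).le)
      hfm.aestronglyMeasurable, Measure.real, hQ, withDensity_apply _ hA]
  have hPE : ∀ {A : Set Ω}, MeasurableSet A → ∫ x in A, (f x - Real.exp ε) ∂P
      = Q.real A - Real.exp ε * P.real A := by
    intro A hA
    rw [integral_sub hint.integrableOn (integrable_const _).integrableOn, hQE hA,
      setIntegral_const, smul_eq_mul, mul_comm]
  set T : Set Ω := ℓ ⁻¹' Set.Ioi (ε + w / 2) with hT
  have hTm : MeasurableSet T := hm measurableSet_Ioi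
  have hTf : ∀ x, x ∈ T ↔ 0 < f x - Real.exp ε := by
    intro x
    simp only [hT, Set.mem_preimage, Set.mem_Ioi, hf, sub_pos, Real.exp_lt_exp]
    constructor <;> intro h <;> linarith
  have hi2 : Integrable (fun x => f x - Real.exp ε) P := hint.sub (integrable_const _)
  have key : Q.real E - Real.exp ε * P.real E ≤ Q.real T - Real.exp ε * P.real T := by
    rw [← hPE hE, ← hPE hTm, ← integral_indicator hE, ← integral_indicator hTm]
    refine integral_mono (hi2.indicator hE) (hi2.indicator hTm) fun x => ?_
    by_cases hxE : x ∈ E <;> by_cases hxT : x ∈ T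
    · simp [hxE, hxT]
    · have := (hTf x).not.1 hxT
      simp only [Set.indicator_of_mem hxE, Set.indicator_of_notMem hxT]
      linarith
    · have := (hTf x).1 hxT
      simp only [Set.indicator_of_notMem hxE, Set.indicator_of_mem hxT]
      linarith
    · simp [hxE, hxT]
  have hPT : P.real T = (gaussianReal 0 w).real (Set.Ioi (ε + w / 2)) := by
    rw [← hl, map_measureReal_apply hm measurableSet_Ioi]
  have hQT : Q.real T = (gaussianReal w w).real (Set.Ioi (ε + w / 2)) := by
    rw [Measure.real, Measure.real, hQ, withDensity_apply _ hTm]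
    have hw' : (w : ℝ) ≠ 0 := by exact_mod_cast hw
    rw [gaussianReal_eq_withDensity w hw (by field_simp : (w : ℝ) = (w : ℝ) ^ 2 / w),
      withDensity_apply _ measurableSet_Ioi, ← hl,
      setLIntegral_map measurableSet_Ioi (by fun_prop) hm]
    congr 1
    refine lintegral_congr fun x => ?_
    rw [mul_div_cancel_left₀ _ hw']
  rw [← hPT, ← hQT]
  linarith

/-! ### Gaussian tails -/

lemma gaussianReal_real_Iic_eq_Phi {u : ℝ≥0} (hu : u ≠ 0) (x : ℝ) :
    (gaussianReal 0 u).real (Set.Iic x) = Phi (x / Real.sqrt u) := by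
  have hs : 0 < Real.sqrt u := Real.sqrt_pos.2 (by positivity)
  have h1 : gaussianReal 0 u = (gaussianReal 0 1).map (fun x => Real.sqrt u * x) := by
    rw [gaussianReal_map_const_mul]
    congr 1
    · simp
    · ext; simp
  rw [Phi, cdf_eq_real, h1, map_measureReal_apply (by fun_prop) measurableSet_Iic]
  congr 1
  ext y
  simp [le_div_iff₀ hs, mul_comm]

lemma gaussianReal_real_Ioi_eq_Phi (m : ℝ) {u : ℝ≥0} (hu : u ≠ 0) (x : ℝ) :
    (gaussianReal m u).real (Set.Ioi x) = Phi ((m - x) / Real.sqrt u) := by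
  have h1 : gaussianReal m u = (gaussianReal 0 u).map (fun x => m - x) := by
    rw [gaussianReal_map_const_sub]; simp
  have := nullSingletonClass_gaussianReal (μ := 0) hu
  rw [h1, map_measureReal_apply (by fun_prop) measurableSet_Ioi,
    ← gaussianReal_real_Iic_eq_Phi hu]
  have : (fun y => m - y) ⁻¹' Set.Ioi x = Set.Iio (m - x) := by
    ext y
    simp only [Set.mem_preimage, Set.mem_Ioi, Set.mem_Iio]
    constructor <;> intro h <;> linarith
  rw [this]
  exact measureReal_congr Iio_ae_eq_Iic

lemma Phi_nonneg (x : ℝ) : 0 ≤ Phi x := cdf_nonneg _ _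

lemma Phi_le_one (x : ℝ) : Phi x ≤ 1 := cdf_le_one _ _

lemma IsGaussianShift.real_le_gaussProfile {Ω : Type*} [MeasurableSpace Ω] {P Q : Measure Ω}
    [IsProbabilityMeasure P] [IsProbabilityMeasure Q] {w : ℝ≥0} (h : IsGaussianShift P Q w)
    {σ g : ℝ} (hσ : 0 < σ) (hg : 0 < g) (hw : (w : ℝ) = (g / σ) ^ 2)
    (ε : ℝ) {E : Set Ω} (hE : MeasurableSet E) :
    Q.real E ≤ Real.exp ε * P.real E + gaussProfile σ g ε := by
  have hr : 0 < g / σ := by positivity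
  have hw0 : w ≠ 0 := by
    rintro rfl
    exact (pow_pos hr 2).ne hw
  have hsq : Real.sqrt w = g / σ := by rw [hw, Real.sqrt_sq hr.le]
  refine (h.real_le hw0 ε hE).trans_eq ?_
  rw [gaussianReal_real_Ioi_eq_Phi _ hw0, gaussianReal_real_Ioi_eq_Phi _ hw0, gaussProfile, hsq, hw]
  congr 5 <;> field_simp <;> ring

/-- The Gaussian profile also bounds shifts that are shorter than `g`: an independent Gaussian
coordinate that the event does not look at can be shifted as well, until the total length is
`g`. -/
lemma IsGaussianShift.real_le_gaussProfile_of_le {Ω : Type*} [MeasurableSpace Ω] {P Q : Measure Ω}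
    [IsProbabilityMeasure P] [IsProbabilityMeasure Q] {w : ℝ≥0} (h : IsGaussianShift P Q w)
    {σ g : ℝ} (hσ : 0 < σ) (hg : 0 < g) (hw : (w : ℝ) ≤ (g / σ) ^ 2)
    (ε : ℝ) {E : Set Ω} (hE : MeasurableSet E) :
    Q.real E ≤ Real.exp ε * P.real E + gaussProfile σ g ε := by
  have hnn : 0 ≤ (g / σ) ^ 2 - w := by linarith
  have h1 : IsGaussianShift (gaussianReal 0 1) (gaussianReal (Real.sqrt ((g / σ) ^ 2 - w)) 1)
      ((g / σ) ^ 2 - w).toNNReal := by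
    refine isGaussianShift_gaussianReal _ one_ne_zero ?_
    simp [Real.sq_sqrt hnn, hw]
  have := (h.prod h1).real_le_gaussProfile hσ hg (by simp [hw]) ε (hE.prod MeasurableSet.univ)
  simpa [measureReal_prod_prod] using this

/-! ### Entries of a histogram in descending order -/

lemma lt_getD_iff_lt_countP {l : List ℕ} (hl : l.Pairwise (· ≥ ·)) (k m : ℕ) :
    m < l.getD k 0 ↔ k < l.countP (fun x => decide (m < x)) := by
  induction l generalizing k with
  | nil => simp
  | cons a l ih =>
    rw [List.pairwise_cons] at hl
    rw [List.countP_cons]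
    have hz : ¬ m < a → l.countP (fun x => decide (m < x)) = 0 := by
      intro h
      rw [List.countP_eq_zero]
      intro x hx
      have := hl.1 x hx
      simp
      omega
    cases k with
    | zero =>
      by_cases h : m < a
      · simp [h]
      · simp [h, hz h]
    | succ k =>
      rw [List.getD_cons_succ, ih hl.2]
      by_cases h : m < a
      · simp [h]
      · simp [h, hz h]

/-- The `(k+1)`-st largest entry exceeds `m` exactly when more than `k` entries do. -/
lemma lt_succLargest_iff {d : ℕ} (h : Fin d → ℕ) (k m : ℕ) :
    m < succLargest h k ↔ k < (Finset.univ.filter fun i => m < h i).card := by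
  rw [succLargest, lt_getD_iff_lt_countP (Multiset.pairwise_sort _ _), ← Multiset.coe_countP,
    Multiset.sort_eq, Multiset.countP_map]
  rfl

lemma succLargest_mono {d : ℕ} {h h' : Fin d → ℕ} (hh : ∀ i, h i ≤ h' i) (k : ℕ) :
    succLargest h k ≤ succLargest h' k := by
  by_contra! hlt
  rw [lt_succLargest_iff] at hlt
  have : succLargest h' k < succLargest h' k := by
    rw [lt_succLargest_iff]
    refine hlt.trans_le (Finset.card_le_card fun i => ?_)
    simp only [Finset.mem_filter, Finset.mem_univ, true_and]
    exact fun hi => hi.trans_le (hh i)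
  exact lt_irrefl _ this

lemma succLargest_le_add_one {d : ℕ} {h h' : Fin d → ℕ} (hh : ∀ i, h' i ≤ h i + 1) (k : ℕ) :
    succLargest h' k ≤ succLargest h k + 1 := by
  by_contra! hlt
  rw [lt_succLargest_iff] at hlt
  have : succLargest h k < succLargest h k := by
    rw [lt_succLargest_iff]
    refine hlt.trans_le (Finset.card_le_card fun i => ?_)
    simp only [Finset.mem_filter, Finset.mem_univ, true_and]
    have := hh i
    omega
  exact lt_irrefl _ this

lemma hist_eraseIdx {d : ℕ} (X : Dataset (Fin d → Bool)) {n : ℕ} (hn : n < X.length) (j : Fin d) :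
    hist X j = (if X[n] j then 1 else 0) + hist (X.eraseIdx n) j := by
  have := ((List.getElem_cons_eraseIdx_perm hn).map
    (fun x : Fin d → Bool => if x j then 1 else 0)).sum_eq
  rw [hist, ← this]
  simp [hist]

lemma card_topkHist_ne_zero_le {d : ℕ} (k : ℕ) (X : Dataset (Fin d → Bool)) :
    (Finset.univ.filter fun i => topkHist k X i ≠ 0).card ≤ k := by
  have := (lt_succLargest_iff (hist X) k (succLargest (hist X) k)).not.1 (lt_irrefl _)
  refine le_trans (Finset.card_le_card fun i => ?_) (not_lt.1 this)
  simp only [Finset.mem_filter, Finset.mem_univ, true_and]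
  exact fun hi => Nat.sub_ne_zero_iff_lt.1 hi

/-- Deleting a data point changes all preprocessed counters in the same direction, by at most one:
if the threshold stays the same they can only decrease, and if it drops by one they can only
increase. -/
lemma topkHist_eraseIdx {d : ℕ} (k : ℕ) (X : Dataset (Fin d → Bool)) {n : ℕ} (hn : n < X.length) :
    (∀ i, topkHist k X i ≤ topkHist k (X.eraseIdx n) i ∧
      topkHist k (X.eraseIdx n) i ≤ topkHist k X i + 1) ∨
    (∀ i, topkHist k (X.eraseIdx n) i ≤ topkHist k X i ∧
      topkHist k X i ≤ topkHist k (X.eraseIdx n) i + 1) := by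
  have hh : ∀ i, hist (X.eraseIdx n) i ≤ hist X i ∧ hist X i ≤ hist (X.eraseIdx n) i + 1 := by
    intro i
    rw [hist_eraseIdx X hn i]
    split_ifs <;> omega
  have h1 := succLargest_mono (fun i => (hh i).1) k
  have h2 := succLargest_le_add_one (fun i => (hh i).2) k
  simp only [topkHist]
  rcases h1.eq_or_lt with h | h
  · right
    intro i
    have := hh i
    omega
  · left
    intro i
    have := hh i
    omega

/-- Neighbouring datasets have preprocessed histograms one of which dominates the other by at most
one in every entry. -/
lemma Neighboring.topkHist {d : ℕ} (k : ℕ) {X X' : Dataset (Fin d → Bool)}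
    (h : Neighboring X X') :
    (∀ i, topkHist k X i ≤ topkHist k X' i ∧ topkHist k X' i ≤ topkHist k X i + 1) ∨
    (∀ i, topkHist k X' i ≤ topkHist k X i ∧ topkHist k X i ≤ topkHist k X' i + 1) := by
  obtain ⟨i, hi, rfl⟩ | ⟨i, hi, rfl⟩ := h
  · exact (topkHist_eraseIdx k X' hi).symm
  · exact topkHist_eraseIdx k X hi

/-! ### Shifting the correlated noise -/

instance (d k : ℕ) (σ : ℝ) : IsProbabilityMeasure (noise d k σ) := by
  unfold noise; infer_instance

lemma isGaussianShift_noise {d k : ℕ} (hk : 1 ≤ k) {σ : ℝ} (hσ : 0 < σ) (b : ℝ) (v : Fin d → ℝ) :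
    IsGaussianShift (noise d k σ) ((noise d k σ).map fun z => z + (b, v))
      ((b ^ 2 * Real.sqrt k + ∑ i, v i ^ 2) / σ ^ 2).toNNReal := by
  have hk' : 0 < Real.sqrt k := Real.sqrt_pos.2 (by exact_mod_cast hk)
  have hu : (0 : ℝ) < σ ^ 2 / Real.sqrt k := by positivity
  have hu' : (0 : ℝ) < σ ^ 2 := by positivity
  have h1 : IsGaussianShift (gaussianReal 0 (σ ^ 2 / Real.sqrt k).toNNReal)
      ((gaussianReal 0 (σ ^ 2 / Real.sqrt k).toNNReal).map (· + b))
      (b ^ 2 / (σ ^ 2 / Real.sqrt k)).toNNReal := by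
    rw [gaussianReal_map_add_const, zero_add]
    refine isGaussianShift_gaussianReal b (by simpa using hu) ?_
    rw [Real.coe_toNNReal _ (by positivity), Real.coe_toNNReal _ hu.le]
  have h2 : IsGaussianShift (Measure.pi fun _ : Fin d => gaussianReal 0 (σ ^ 2).toNNReal)
      ((Measure.pi fun _ : Fin d => gaussianReal 0 (σ ^ 2).toNNReal).map (· + v))
      (∑ i, (v i ^ 2 / σ ^ 2).toNNReal) := by
    have := Measure.pi_map_pi (μ := fun _ : Fin d => gaussianReal 0 (σ ^ 2).toNNReal)
      (f := fun i x => x + v i) (fun i => by fun_prop)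
    have e : (fun x : Fin d → ℝ => x + v) = fun x i => x i + v i := rfl
    rw [e, this]
    have : ∀ i, IsProbabilityMeasure ((gaussianReal 0 (σ ^ 2).toNNReal).map (fun x => x + v i)) :=
      fun i => Measure.isProbabilityMeasure_map (by fun_prop)
    refine IsGaussianShift.pi fun i => ?_
    rw [gaussianReal_map_add_const, zero_add]
    refine isGaussianShift_gaussianReal _ (by simpa using hσ.ne') ?_
    rw [Real.coe_toNNReal _ (by positivity), Real.coe_toNNReal _ hu'.le]
  have h3 := h1.prod h2
  rw [Measure.map_prod_map _ _ (by fun_prop) (by fun_prop)] at h3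
  unfold noise
  convert h3 using 1
  · rfl
  rw [← NNReal.coe_inj, NNReal.coe_add, NNReal.coe_sum]
  rw [Real.coe_toNNReal _ (by positivity), Real.coe_toNNReal _ (by positivity)]
  simp_rw [Real.coe_toNNReal _ (div_nonneg (sq_nonneg (v _)) hu'.le)]
  rw [← Finset.sum_div]
  field_simp

/-- Shifting the noise by `(b, v)` costs at most the Gaussian profile of any `g` whose square is at
least `√k b² + ∑ vᵢ²`. -/
lemma noise_real_add_le {d k : ℕ} (hk : 1 ≤ k) {σ : ℝ} (hσ : 0 < σ) (b : ℝ) (v : Fin d → ℝ)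
    {g : ℝ} (hg : 0 < g) (hw : b ^ 2 * Real.sqrt k + ∑ i, v i ^ 2 ≤ g ^ 2) (ε : ℝ)
    {E : Set (ℝ × (Fin d → ℝ))} (hE : MeasurableSet E) :
    (noise d k σ).real {z | z + (b, v) ∈ E} ≤
      Real.exp ε * (noise d k σ).real E + gaussProfile σ g ε := by
  have hm : Measurable fun z : ℝ × (Fin d → ℝ) => z + (b, v) := by fun_prop
  have : IsProbabilityMeasure ((noise d k σ).map fun z => z + (b, v)) :=
    Measure.isProbabilityMeasure_map hm.aemeasurable
  have h := (isGaussianShift_noise hk hσ b v).real_le_gaussProfile_of_le hσ hg (by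
    rw [Real.coe_toNNReal _ (div_nonneg (add_nonneg (by positivity)
      (Finset.sum_nonneg fun i _ => sq_nonneg (v i))) (by positivity)), div_pow]
    gcongr) ε hE
  rwa [map_measureReal_apply hm hE] at h

lemma rpow_neg_quarter_pos {k : ℕ} (hk : 1 ≤ k) : 0 < (k : ℝ) ^ (-(1 / 4) : ℝ) :=
  Real.rpow_pos_of_pos (by exact_mod_cast hk) _

lemma sqrt_var_corr {k : ℕ} (hk : 1 ≤ k) {σ : ℝ} (hσ : 0 < σ) :
    Real.sqrt (σ ^ 2 / Real.sqrt k) = σ * (k : ℝ) ^ (-(1 / 4) : ℝ) := by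
  have hk' : (0 : ℝ) < k := by exact_mod_cast hk
  have hc := rpow_neg_quarter_pos hk
  rw [Real.sqrt_eq_iff_mul_self_eq (by positivity) (by positivity)]
  have : (k : ℝ) ^ (-(1 / 4) : ℝ) * (k : ℝ) ^ (-(1 / 4) : ℝ) = (Real.sqrt k)⁻¹ := by
    rw [← Real.rpow_add hk', Real.sqrt_eq_rpow, ← Real.rpow_neg hk'.le]
    norm_num
  symm
  calc _ = σ ^ 2 * ((k : ℝ) ^ (-(1 / 4) : ℝ) * (k : ℝ) ^ (-(1 / 4) : ℝ)) := by ring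
    _ = _ := by rw [this]; ring

/-- With probability at least `ψ(|A|)` no counter in `A` receives noise above `τ`. The level `τ` is
divided between `Z_corr` and `Z_i` in proportion to their standard deviations, so that each of the
`|A| + 1` independent constraints has the same probability. -/
lemma psi_le_noise_real {d k : ℕ} (hk : 1 ≤ k) {σ τ : ℝ} (hσ : 0 < σ) (A : Finset (Fin d)) :
    psi k σ τ A.card ≤ (noise d k σ).real {z | ∀ i ∈ A, z.2 i + z.1 ≤ τ} := by
  classical
  set c : ℝ := (k : ℝ) ^ (-(1 / 4) : ℝ) with hc
  have hc0 : 0 < c := rpow_neg_quarter_pos hk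
  have hk' : 0 < Real.sqrt k := Real.sqrt_pos.2 (by exact_mod_cast hk)
  have hu : (0 : ℝ) < σ ^ 2 / Real.sqrt k := by positivity
  have hu' : (0 : ℝ) < σ ^ 2 := by positivity
  set B : Fin d → Set ℝ := fun i => if i ∈ A then Set.Iic (τ / (1 + c)) else Set.univ with hB
  have hsub : Set.Iic (τ * c / (1 + c)) ×ˢ Set.univ.pi B ⊆
      {z : ℝ × (Fin d → ℝ) | ∀ i ∈ A, z.2 i + z.1 ≤ τ} := by
    rintro ⟨x, y⟩ ⟨hx, hy⟩ i hi
    have hyi := hy i (Set.mem_univ i)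
    simp only [hB, hi, if_true, Set.mem_Iic] at hyi hx
    have : τ / (1 + c) + τ * c / (1 + c) = τ := by field_simp
    simp only
    linarith
  refine le_trans (le_of_eq ?_) (measureReal_mono hsub)
  have e1 : (gaussianReal 0 (σ ^ 2 / Real.sqrt k).toNNReal).real (Set.Iic (τ * c / (1 + c))) =
      Phi (τ / ((1 + c) * σ)) := by
    rw [gaussianReal_real_Iic_eq_Phi (by simpa using hu), Real.coe_toNNReal _ hu.le,
      sqrt_var_corr hk hσ, ← hc]
    congr 1
    field_simp
  have e2 : (gaussianReal 0 (σ ^ 2).toNNReal).real (Set.Iic (τ / (1 + c))) =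
      Phi (τ / ((1 + c) * σ)) := by
    rw [gaussianReal_real_Iic_eq_Phi (by simpa using hσ.ne'), Real.coe_toNNReal _ hu'.le,
      Real.sqrt_sq hσ.le]
    congr 1
    field_simp
  rw [noise, measureReal_prod_prod, e1, psi, pow_succ', measureReal_def, Measure.pi_pi,
    ENNReal.toReal_prod]
  congr 1
  have : ∀ i, ((gaussianReal 0 (σ ^ 2).toNNReal) (B i)).toReal =
      if i ∈ A then Phi (τ / ((1 + c) * σ)) else 1 := by
    intro i
    by_cases hi : i ∈ A
    · simp only [hB, hi, if_true]
      exact e2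
    · simp [hB, hi]
  simp_rw [this]
  simp [Finset.prod_ite_mem, hc]

/-! ### Comparing the outputs on two histograms -/

/-- The counters that are zero in `h` but not in `h'`. -/
def newCounters {d : ℕ} (h h' : Fin d → ℕ) : Finset (Fin d) :=
  Finset.univ.filter fun i => h i = 0 ∧ h' i ≠ 0

/-- If no new counter passes the threshold, then replacing `h` by `h'` has the same effect on the
output as shifting the noise. -/
lemma cshOutput_eq_cshOutput_add {d : ℕ} {h h' : Fin d → ℕ}
    (hh : ∀ i, h i ≤ h' i ∧ h' i ≤ h i + 1) {b : ℝ} {v : Fin d → ℝ}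
    (hv : ∀ i, h i ≠ 0 → b + v i = h' i - h i) {τ : ℝ} {z : ℝ × (Fin d → ℝ)}
    (hz : ∀ i ∈ newCounters h h', z.2 i + z.1 ≤ τ) :
    cshOutput τ h' z = cshOutput τ h (z + (b, v)) := by
  ext i
  by_cases hi : h i = 0
  · by_cases hi' : h' i = 0
    · simp [cshOutput, hi, hi']
    · have h1 : h' i = 1 := by have := hh i; omega
      have := hz i (by simp [newCounters, hi, hi'])
      have hn : ¬ (τ < z.2 i + z.1) := by linarith
      simp [cshOutput, hi, h1, add_assoc, hn]
  · have hi' : h' i ≠ 0 := by have := hh i; omega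
    have e : (h' i : ℝ) + z.2 i + z.1 = (h i : ℝ) + (z.2 i + v i) + (z.1 + b) := by
      have := hv i hi
      linarith
    simp [cshOutput, hi, hi', e]

/-- The two directions of the comparison. Going from `h'` to `h`, the event that no new counter
passes the threshold is discarded before the noise is shifted. Going from `h` to `h'`, it is kept
inside the event whose noise is shifted, and the shift preserves it because `Z_corr` is shifted by
`b ≥ 0` and the `Z_i` of new counters are not shifted. -/
lemma csh_real_le_of_shift {d k : ℕ} {σ τ ε : ℝ} {h h' : Fin d → ℕ}
    (hh : ∀ i, h i ≤ h' i ∧ h' i ≤ h i + 1) {b : ℝ} (hb : 0 ≤ b) {v : Fin d → ℝ}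
    (hv : ∀ i, h i ≠ 0 → b + v i = h' i - h i) (hv0 : ∀ i, h i = 0 → v i = 0) {r B : ℝ}
    (hr : 1 - r ≤ (noise d k σ).real {z | ∀ i ∈ newCounters h h', z.2 i + z.1 ≤ τ})
    (hB : ∀ E : Set (ℝ × (Fin d → ℝ)), MeasurableSet E →
      (noise d k σ).real {z | z + (b, v) ∈ E} ≤ Real.exp ε * (noise d k σ).real E + B ∧
      (noise d k σ).real E ≤ Real.exp ε * (noise d k σ).real {z | z + (b, v) ∈ E} + B)
    {S : Set (Fin d → ℝ)} (hS : MeasurableSet S) :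
    (csh k σ τ h').real S ≤ Real.exp ε * (csh k σ τ h).real S + (B + r) ∧
    (csh k σ τ h).real S ≤ Real.exp ε * (csh k σ τ h').real S + (B + r) := by
  simp only [csh, map_measureReal_apply (measurable_cshOutput _ _) hS]
  set N := noise d k σ
  set G : Set (ℝ × (Fin d → ℝ)) := {z | ∀ i ∈ newCounters h h', z.2 i + z.1 ≤ τ} with hG
  have hGm : MeasurableSet G := by
    have : G = ⋂ i ∈ newCounters h h', {z | z.2 i + z.1 ≤ τ} := by ext z; simp [hG]
    rw [this]
    exact Finset.measurableSet_biInter _ fun i _ =>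
      measurableSet_le (by fun_prop) measurable_const
  have hGc : N.real Gᶜ ≤ r := by
    rw [probReal_compl_eq_one_sub hGm]
    linarith
  have split : ∀ E : Set (ℝ × (Fin d → ℝ)), N.real E ≤ N.real (E ∩ G) + r := by
    intro E
    calc N.real E ≤ N.real (E ∩ G ∪ Gᶜ) := by
          refine measureReal_mono fun z hz => ?_
          by_cases hzG : z ∈ G
          · exact Or.inl ⟨hz, hzG⟩
          · exact Or.inr hzG
      _ ≤ N.real (E ∩ G) + N.real Gᶜ := measureReal_union_le _ _
      _ ≤ _ := by linarith
  have hSm : MeasurableSet (cshOutput τ h ⁻¹' S) := measurable_cshOutput _ _ hS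
  constructor
  · have h1 := split (cshOutput τ h' ⁻¹' S)
    have h2 : N.real (cshOutput τ h' ⁻¹' S ∩ G) ≤
        N.real {z | z + (b, v) ∈ cshOutput τ h ⁻¹' S} := by
      refine measureReal_mono fun z hz => ?_
      simp only [Set.mem_ofPred_eq, Set.mem_preimage, ← cshOutput_eq_cshOutput_add hh hv hz.2]
      exact hz.1
    linarith [(hB _ hSm).1]
  · have h1 := split (cshOutput τ h ⁻¹' S)
    have h2 : N.real {z | z + (b, v) ∈ cshOutput τ h ⁻¹' S ∩ G} ≤
        N.real (cshOutput τ h' ⁻¹' S) := by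
      refine measureReal_mono fun z hz => ?_
      have hzG : z ∈ G := by
        intro i hi
        have h3 := hz.2 i hi
        simp only [newCounters, Finset.mem_filter] at hi
        simp only [Prod.snd_add, Prod.fst_add, Pi.add_apply, hv0 i hi.2.1] at h3
        linarith
      rw [Set.mem_preimage, cshOutput_eq_cshOutput_add hh hv hzG]
      exact hz.1
    have h3 := mul_le_mul_of_nonneg_left h2 (Real.exp_nonneg ε)
    linarith [(hB _ (hSm.inter hGm)).2]

/-- The cheapest noise shift that increases `j` of `s` counters by one: it puts `j / (√k + s)` on
the shared noise, and its squared length is `j - j² / (√k + s)`. As a function of `j` this is at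
most `(s + √k) / 4`, the value at the vertex `j = (s + √k) / 2`. -/
lemma shift_cost_le {q s j : ℝ} (hq : 0 < q) (hj : 0 ≤ j) (hjs : j ≤ s) :
    (j / (q + s)) ^ 2 * q + ((s - j) * (j / (q + s)) ^ 2 + j * (1 - j / (q + s)) ^ 2) ≤
      min s ((s + q) / 4) := by
  have hp : 0 < q + s := by linarith
  have e : (j / (q + s)) ^ 2 * q + ((s - j) * (j / (q + s)) ^ 2 + j * (1 - j / (q + s)) ^ 2) =
      j - j ^ 2 / (q + s) := by
    field_simp
    ring
  rw [e]
  refine le_min ?_ ?_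
  · have : 0 ≤ j ^ 2 / (q + s) := by positivity
    linarith
  · have : (q + s) / 4 - (j - j ^ 2 / (q + s)) = (q + s - 2 * j) ^ 2 / (4 * (q + s)) := by
      field_simp
      ring
    have h2 : 0 ≤ (q + s - 2 * j) ^ 2 / (4 * (q + s)) := by positivity
    linarith

/-- The guarantee for two histograms that differ by at most one in every entry, all in the same
direction, where `s` is the number of non-zero counters of the smaller one. The additive error is
the failure probability `r` plus the cost `B` of the shift. The case `s = 0` is separate because the
profile is meaningful only for `g > 0`. -/
lemma csh_real_le {d k : ℕ} (hk : 1 ≤ k) {σ τ ε : ℝ} (hσ : 0 < σ) (hε : 0 ≤ ε) {h h' : Fin d → ℕ}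
    (hh : ∀ i, h i ≤ h' i ∧ h' i ≤ h i + 1) {s : ℕ}
    (hs : (Finset.univ.filter fun i => h i ≠ 0).card = s) {r B : ℝ}
    (hr : 1 - r ≤ (noise d k σ).real {z | ∀ i ∈ newCounters h h', z.2 i + z.1 ≤ τ})
    (hB : (s = 0 ∧ B = 0) ∨
      ∃ g, 0 < g ∧ min (s : ℝ) ((s + Real.sqrt k) / 4) ≤ g ^ 2 ∧ B = gaussProfile σ g ε)
    {S : Set (Fin d → ℝ)} (hS : MeasurableSet S) :
    (csh k σ τ h').real S ≤ Real.exp ε * (csh k σ τ h).real S + (B + r) ∧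
    (csh k σ τ h).real S ≤ Real.exp ε * (csh k σ τ h').real S + (B + r) := by
  have hq : 0 < Real.sqrt k := Real.sqrt_pos.2 (by exact_mod_cast hk)
  set q := Real.sqrt k with hqdef
  set U : Finset (Fin d) := Finset.univ.filter fun i => h i ≠ 0 with hU
  set J : Finset (Fin d) := U.filter fun i => h' i = h i + 1 with hJ
  have hJs : J.card ≤ s := hs ▸ Finset.card_filter_le _ _
  set b : ℝ := J.card / (q + s) with hb
  set v : Fin d → ℝ := fun i => if h i ≠ 0 then (h' i - h i) - b else 0 with hv
  have hb0 : 0 ≤ b := by positivity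
  have hv1 : ∀ i, h i ≠ 0 → b + v i = h' i - h i := by
    intro i hi
    simp [hv, hi]
  have hv0 : ∀ i, h i = 0 → v i = 0 := by
    intro i hi
    simp [hv, hi]
  have hsum : ∑ i, v i ^ 2 = (s - J.card) * b ^ 2 + J.card * (1 - b) ^ 2 := by
    have e1 : ∑ i, v i ^ 2 = ∑ i ∈ U, v i ^ 2 := by
      symm
      refine Finset.sum_subset (Finset.subset_univ _) fun i _ hi => ?_
      rw [hv0 i (by simpa [hU] using hi)]
      ring
    have e2 : ∑ i ∈ U, v i ^ 2 = ∑ i ∈ U, if h' i = h i + 1 then (1 - b) ^ 2 else b ^ 2 := by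
      refine Finset.sum_congr rfl fun i hi => ?_
      have hi' : h i ≠ 0 := by simpa [hU] using hi
      simp only [hv, hi', ne_eq, not_false_eq_true, if_true]
      split_ifs with h1
      · rw [h1]; push_cast; ring
      · have : h' i = h i := by have := hh i; omega
        rw [this]; ring
    have e3 : ((U.filter fun i => ¬ h' i = h i + 1).card : ℝ) = s - J.card := by
      rw [eq_sub_iff_add_eq', ← hs]
      exact_mod_cast Finset.card_filter_add_card_filter_not (s := U) (fun i => h' i = h i + 1)
    rw [e1, e2, Finset.sum_ite, Finset.sum_const, Finset.sum_const, nsmul_eq_mul, nsmul_eq_mul, e3]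
    ring
  have hcost : b ^ 2 * q + ∑ i, v i ^ 2 ≤ min (s : ℝ) ((s + q) / 4) := by
    rw [hsum]
    exact shift_cost_le hq (by positivity) (by exact_mod_cast hJs)
  refine csh_real_le_of_shift hh hb0 hv1 hv0 hr (fun E hE => ?_) hS
  rcases hB with ⟨hs0, rfl⟩ | ⟨g, hg, hgs, rfl⟩
  · have hJ0 : J.card = 0 := by omega
    have hb' : b = 0 := by simp [hb, hJ0]
    have hU0 : U = ∅ := Finset.card_eq_zero.1 (hs.trans hs0)
    have hv' : v = 0 := by
      ext i
      refine hv0 i ?_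
      by_contra hi
      have : i ∈ U := by simp [hU, hi]
      simp [hU0] at this
    have hz : ∀ z : ℝ × (Fin d → ℝ), z + (b, v) = z := by
      intro z
      rw [hb', hv']
      exact add_zero z
    simp only [hz, Set.ofPred_mem_eq, add_zero, and_self]
    exact le_mul_of_one_le_left measureReal_nonneg (Real.one_le_exp hε)
  · refine ⟨noise_real_add_le hk hσ b v hg (hcost.trans hgs) ε hE, ?_⟩
    have hm : Measurable fun z : ℝ × (Fin d → ℝ) => z + (b, v) := by fun_prop
    have h1 := noise_real_add_le hk hσ (-b) (-v) (g := g) hg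
      (by simpa using hcost.trans hgs) ε (hm hE)
    have hz : ∀ z : ℝ × (Fin d → ℝ), z + (-b, -v) + (b, v) = z := by
      intro z
      rw [← Prod.neg_mk, neg_add_cancel_right]
    simp only [Set.mem_preimage, hz, Set.ofPred_mem_eq] at h1
    exact h1

/-! ### The two privacy guarantees -/

lemma deltaGauss_eq_gaussProfile (k : ℕ) (σ ε : ℝ) :
    deltaGauss k σ ε = gaussProfile σ (1 / 2 * Real.sqrt (k + Real.sqrt k)) ε := by
  rw [deltaGauss, gaussProfile]
  have e1 : 1 / 2 * Real.sqrt (k + Real.sqrt k) / (2 * σ) =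
      Real.sqrt (k + Real.sqrt k) / (4 * σ) := by
    ring
  have e2 : ε * σ / (1 / 2 * Real.sqrt (k + Real.sqrt k)) =
      2 * ε * σ / Real.sqrt (k + Real.sqrt k) := by
    rw [mul_comm (1 / 2 : ℝ), mul_one_div, div_div_eq_mul_div]
    ring
  rw [e1, e2]

lemma deltaInf_eq (k : ℕ) (σ τ : ℝ) : deltaInf k σ τ = 1 - psi k σ τ k := by
  rw [deltaInf, psi, mul_comm σ]

lemma psi_antitone (k : ℕ) (σ τ : ℝ) : Antitone (psi k σ τ) := fun _ _ h =>
  pow_le_pow_of_le_one (Phi_nonneg _) (Phi_le_one _) (by omega)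

lemma half_sqrt_sq (s k : ℕ) :
    (1 / 2 * Real.sqrt (s + Real.sqrt k)) ^ 2 = (s + Real.sqrt k) / 4 := by
  rw [mul_pow, Real.sq_sqrt (by positivity)]
  ring

lemma half_sqrt_pos {k : ℕ} (hk : 1 ≤ k) (s : ℕ) : 0 < 1 / 2 * Real.sqrt (s + Real.sqrt k) := by
  have : (0 : ℝ) < k := by exact_mod_cast hk
  positivity

lemma gam_pos {k s : ℕ} (hk : 1 ≤ k) (hs : 1 ≤ s) : 0 < gam k s :=
  lt_min (Real.sqrt_pos.2 (by exact_mod_cast hs)) (half_sqrt_pos hk s)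

lemma min_le_gam_sq (k s : ℕ) : min (s : ℝ) ((s + Real.sqrt k) / 4) ≤ gam k s ^ 2 := by
  rw [gam]
  rcases min_choice (Real.sqrt s) (1 / 2 * Real.sqrt (s + Real.sqrt k)) with h | h <;> rw [h]
  · rw [Real.sq_sqrt (by positivity)]
    exact min_le_left _ _
  · rw [half_sqrt_sq]
    exact min_le_right _ _

lemma card_newCounters {d : ℕ} {h h' : Fin d → ℕ} (hh : ∀ i, h i ≤ h' i) :
    (newCounters h h').card + (Finset.univ.filter fun i => h i ≠ 0).card =
      (Finset.univ.filter fun i => h' i ≠ 0).card := by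
  rw [newCounters, ← Finset.card_union_of_disjoint]
  · congr 1
    ext i
    simp only [Finset.mem_union, Finset.mem_filter, Finset.mem_univ, true_and]
    have := hh i
    omega
  · rw [Finset.disjoint_filter]
    tauto

/-- It suffices to treat histograms with at most `k` non-zero counters one of which dominates the
other. -/
lemma isDP_topkMechanism_of_csh {d k : ℕ} {σ τ ε δ : ℝ}
    (H : ∀ h h' : Fin d → ℕ, (∀ i, h i ≤ h' i ∧ h' i ≤ h i + 1) →
      (Finset.univ.filter fun i => h' i ≠ 0).card ≤ k →
      ∀ S : Set (Fin d → ℝ), MeasurableSet S →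
      (csh k σ τ h').real S ≤ Real.exp ε * (csh k σ τ h).real S + δ ∧
      (csh k σ τ h).real S ≤ Real.exp ε * (csh k σ τ h').real S + δ) :
    IsDP (topkMechanism d k σ τ) ε δ := by
  intro X X' hX S hS
  rcases hX.topkHist k with h | h
  · exact (H _ _ h (card_topkHist_ne_zero_le k X') S hS).2
  · exact (H _ _ h (card_topkHist_ne_zero_le k X) S hS).1

theorem isDP_topkMechanism_add (d : ℕ) {k : ℕ} (hk : 1 ≤ k) {σ ε : ℝ} (τ : ℝ) (hσ : 0 < σ)
    (hε : 0 ≤ ε) :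
    IsDP (topkMechanism d k σ τ) ε (deltaGauss k σ ε + deltaInf k σ τ) := by
  refine isDP_topkMechanism_of_csh fun h h' hh hcard S hS => ?_
  have hc := card_newCounters fun i => (hh i).1
  refine csh_real_le hk hσ hε hh rfl ?_ (Or.inr ⟨_, half_sqrt_pos hk k, ?_,
    deltaGauss_eq_gaussProfile k σ ε⟩) hS
  · rw [deltaInf_eq, sub_sub_cancel]
    exact (psi_antitone k σ τ (by omega)).trans (psi_le_noise_real hk hσ _)
  · rw [half_sqrt_sq]
    refine (min_le_right _ _).trans ?_
    gcongr
    omega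

theorem isDP_topkMechanism_of_tighterBound (d : ℕ) {k : ℕ} (hk : 1 ≤ k) {σ τ ε δ : ℝ}
    (hσ : 0 < σ) (hε : 0 ≤ ε) (hδ : TighterBound k σ τ ε δ) :
    IsDP (topkMechanism d k σ τ) ε δ := by
  obtain ⟨h0, hgauss, hmid, -⟩ := hδ
  refine isDP_topkMechanism_of_csh fun h h' hh hcard S hS => ?_
  have hc := card_newCounters fun i => (hh i).1
  obtain ⟨s, hs⟩ : ∃ s, (Finset.univ.filter fun i => h i ≠ 0).card = s := ⟨_, rfl⟩
  have hr : ∀ m, (newCounters h h').card ≤ m → 1 - (1 - psi k σ τ m) ≤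
      (noise d k σ).real {z | ∀ i ∈ newCounters h h', z.2 i + z.1 ≤ τ} := by
    intro m hm
    rw [sub_sub_cancel]
    exact (psi_antitone k σ τ hm).trans (psi_le_noise_real hk hσ _)
  -- It is enough to bound the sum of the cost of the shift and the failure probability.
  have of_le : ∀ {x : ℝ}, x ≤ δ →
      ((csh k σ τ h').real S ≤ Real.exp ε * (csh k σ τ h).real S + x ∧
      (csh k σ τ h).real S ≤ Real.exp ε * (csh k σ τ h').real S + x) →
      ((csh k σ τ h').real S ≤ Real.exp ε * (csh k σ τ h).real S + δ ∧
      (csh k σ τ h).real S ≤ Real.exp ε * (csh k σ τ h').real S + δ) :=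
    fun hx H => ⟨H.1.trans (by gcongr), H.2.trans (by gcongr)⟩
  rcases Nat.eq_zero_or_pos s with hs0 | hs0
  · refine of_le ?_ (csh_real_le hk hσ hε hh hs (hr k (by omega)) (Or.inl ⟨hs0, rfl⟩) hS)
    simpa using h0
  rcases (show s ≤ k by omega).eq_or_lt with hsk | hsk
  · -- All `k` counters are in use, so there is no new counter and nothing can fail.
    have hA : newCounters h h' = ∅ := Finset.card_eq_zero.1 (by omega)
    refine of_le ?_ (csh_real_le (r := 0) hk hσ hε hh hs (by simp [hA]) (Or.inr
      ⟨_, half_sqrt_pos hk k, ?_, deltaGauss_eq_gaussProfile k σ ε⟩) hS)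
    · simpa using hgauss
    · rw [half_sqrt_sq, hsk]
      exact min_le_right _ _
  · refine of_le ?_ (csh_real_le hk hσ hε hh hs (hr (k - s) (by omega)) (Or.inr
      ⟨_, gam_pos hk hs0, min_le_gam_sq k s, rfl⟩) hS)
    have := hmid s (Finset.mem_Icc.2 ⟨hs0, by omega⟩)
    linarith

end TopK

theorem mainTheorem4 (d k : ℕ) (hk : 1 ≤ k) (σ τ ε : ℝ) (hσ : 0 < σ) (hτ : 0 < τ) (hε : 0 ≤ ε) :
    TopK.IsDP (TopK.topkMechanism d k σ τ) ε (TopK.deltaGauss k σ ε + TopK.deltaInf k σ τ) ∧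
    ∀ δ : ℝ, TopK.TighterBound k σ τ ε δ → TopK.IsDP (TopK.topkMechanism d k σ τ) ε δ :=
  ⟨TopK.isDP_topkMechanism_add d hk τ hσ hε,
    fun _ hδ => TopK.isDP_topkMechanism_of_tighterBound d hk hσ hε hδ⟩
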